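/- Theorem. A random vector $Z=(Z_1,\dots,Z_d)$ with $Z_i\ge 0$ almost surely and $E(Z_i)=1$ for $1\le i\le d$ is called a generator; it generates the $D$-norm $$\|x\|_D:=E\Big(\max_{1\le i\le d}|x_i|Z_i\Big),\qquad x\in\mathbb R^d,$$ and the $D$-norms on $\mathbb R^d$ are the functions obtained in this way. For $D$-norms $\|\cdot\|_{D^{(1)}},\|\cdot\|_{D^{(2)}}$ let $\|\cdot\|_{D^{(1)}D^{(2)}}$ be the $D$-norm generated by the componentwise product $Z^{(1)}Z^{(2)}$ of independent generators $Z^{(1)}$ of $\|\cdot\|_{D^{(1)}}$ and $Z^{(2)}$ of $\|\cdot\|_{D^{(2)}}$ (it does not depend on the choice of these generators). Put $\|\cdot\|_{D^1}:=\|\cdot\|_D$ and $\|\cdot\|_{D^{n+1}}:=\|\cdot\|_{DD^n}$ for $n\in\mathbb N$. Let $\|\cdot\|_D$ be an arbitrary $D$-norm on $\mathbb R^d$. Then for every $x\in\mathbb R^d$ the sequence $\|x\|_{D^n}$, $n\in\mathbb N$, is nondecreasing and converges to a finite limit $$\|x\|_{D^*}:=\lim_{n\to\infty}\|x\|_{D^n}.$$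 The function $\|\cdot\|_{D^*}$ is a $D$-norm on $\mathbb R^d$, and it is idempotent, that is, $\|\cdot\|_{D^*D^*}=\|\cdot\|_{D^*}$. -/

import Mathlib

open MeasureTheory ProbabilityTheory Filter Topology

namespace DNormTheory

/-- The random vector `Z = (Z₁, …, Z_d)` on the probability space `(Ω, P)` is a generator:
`Z i ≥ 0` almost surely and `E (Z i) = 1` for every `i`. (Measurability of `Z` up to a null set
is part of the integrability of the components.) -/
structure IsGenerator {d : ℕ} {Ω : Type*} [MeasurableSpace Ω] (P : Measure Ω)
    (Z : Ω → Fin d → ℝ) : Prop where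
  isProbabilityMeasure : IsProbabilityMeasure P
  nonneg : ∀ i, ∀ᵐ ω ∂P, 0 ≤ Z ω i
  integrable : ∀ i, Integrable (fun ω => Z ω i) P
  mean_eq_one : ∀ i, ∫ ω, Z ω i ∂P = 1

/-- The random vector `Z` generates the function `N` on `ℝ^d`: `Z` is a generator and
`N x = E ‖x Z‖_∞ = E (max_i |x i| Z i)` for all `x`. Products of vectors are componentwise, and
the norm on `Fin d → ℝ` is the maximum norm. -/
def Generates {d : ℕ} {Ω : Type*} [MeasurableSpace Ω] (P : Measure Ω)
    (Z : Ω → Fin d → ℝ) (N : (Fin d → ℝ) → ℝ) : Prop :=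
  IsGenerator P Z ∧ ∀ x, N x = ∫ ω, ‖x * Z ω‖ ∂P

/-- `N` is a `D`-norm on `ℝ^d`: it is generated by some random vector. -/
def IsDNorm {d : ℕ} (N : (Fin d → ℝ) → ℝ) : Prop :=
  ∃ (Ω : Type) (_ : MeasurableSpace Ω) (P : Measure Ω) (Z : Ω → Fin d → ℝ), Generates P Z N

/-- The set of all `D`-norms on `ℝ^d`. -/
structure DNorm (d : ℕ) where
  toFun : (Fin d → ℝ) → ℝ
  isDNorm : IsDNorm toFun

instance {d : ℕ} : CoeFun (DNorm d) (fun _ => (Fin d → ℝ) → ℝ) := ⟨DNorm.toFun⟩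

section Generators

variable {d : ℕ} {Ω : Type*} [MeasurableSpace Ω] {P : Measure Ω} {Z : Ω → Fin d → ℝ}

theorem IsGenerator.aemeasurable (h : IsGenerator P Z) : AEMeasurable Z P :=
  aemeasurable_pi_lambda _ fun i => (h.integrable i).aemeasurable

theorem continuous_norm_mul (x : Fin d → ℝ) : Continuous (fun z : Fin d → ℝ => ‖x * z‖) :=
  (continuous_const.mul continuous_id).norm

theorem IsGenerator.integrable_norm (h : IsGenerator P Z) (x : Fin d → ℝ) :
    Integrable (fun ω => ‖x * Z ω‖) P := by
  have hZ : Integrable Z P := Integrable.of_eval h.integrable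
  refine (hZ.norm.const_mul ‖x‖).mono'
    ((continuous_norm_mul x).measurable.comp_aemeasurable h.aemeasurable).aestronglyMeasurable ?_
  filter_upwards with ω
  rw [norm_norm]
  exact norm_mul_le x (Z ω)

/-- The law of a generator, with the identity map on `ℝ^d`, is a generator of the same function. -/
theorem Generates.law {N : (Fin d → ℝ) → ℝ} (h : Generates P Z N) :
    Generates (P.map Z) (fun z => z) N := by
  have hm := h.1.aemeasurable
  have hP := h.1.isProbabilityMeasure
  refine ⟨⟨Measure.isProbabilityMeasure_map hm, fun i => ?_, fun i => ?_, fun i => ?_⟩,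
    fun x => ?_⟩
  · rw [ae_map_iff hm (measurableSet_le measurable_const (measurable_pi_apply i))]
    exact h.1.nonneg i
  · exact (integrable_map_measure (measurable_pi_apply i).aestronglyMeasurable hm).2
      (h.1.integrable i)
  · rw [integral_map hm (measurable_pi_apply i).aestronglyMeasurable]
    exact h.1.mean_eq_one i
  · rw [integral_map hm (continuous_norm_mul x).aestronglyMeasurable]
    exact h.2 x

/-- The componentwise product of two independent generators is a generator. -/
theorem IsGenerator.mul {W : Ω → Fin d → ℝ} (hZ : IsGenerator P Z) (hW : IsGenerator P W)
    (hi : IndepFun Z W P) : IsGenerator P (fun ω => Z ω * W ω) := by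
  have hi' : ∀ i, IndepFun (fun ω => Z ω i) (fun ω => W ω i) P := fun i =>
    hi.comp (measurable_pi_apply i) (measurable_pi_apply i)
  refine ⟨hZ.isProbabilityMeasure, fun i => ?_, fun i => ?_, fun i => ?_⟩
  · filter_upwards [hZ.nonneg i, hW.nonneg i] with ω h1 h2
    exact mul_nonneg h1 h2
  · exact (hi' i).integrable_mul (hZ.integrable i) (hW.integrable i)
  · have := (hi' i).integral_mul_eq_mul_integral (hZ.integrable i).aestronglyMeasurable
      (hW.integrable i).aestronglyMeasurable
    rw [hZ.mean_eq_one i, hW.mean_eq_one i, one_mul] at this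
    exact this

/-- Conditioning on the second of two independent generators. -/
theorem integral_norm_mul_mul {W : Ω → Fin d → ℝ} {N : (Fin d → ℝ) → ℝ} (hZ : Generates P Z N)
    (hW : IsGenerator P W) (hi : IndepFun Z W P) (x : Fin d → ℝ) :
    ∫ ω, ‖x * (Z ω * W ω)‖ ∂P = ∫ ω, N (x * W ω) ∂P := by
  have hP := hW.isProbabilityMeasure
  have hmZ := hZ.1.aemeasurable
  have hmW := hW.aemeasurable
  have hPZ := Measure.isProbabilityMeasure_map hmZ
  have hPW := Measure.isProbabilityMeasure_map hmW
  have hc : Continuous (fun p : (Fin d → ℝ) × (Fin d → ℝ) => ‖x * (p.1 * p.2)‖) := by fun_prop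
  have hmap := (indepFun_iff_map_prod_eq_prod_map_map hmZ hmW).1 hi
  have hint : Integrable (fun p : (Fin d → ℝ) × (Fin d → ℝ) => ‖x * (p.1 * p.2)‖)
      ((P.map Z).prod (P.map W)) := by
    rw [← hmap, integrable_map_measure hc.aestronglyMeasurable (hmZ.prodMk hmW)]
    exact (hZ.1.mul hW hi).integrable_norm x
  have hN : ∀ w, ∫ z, ‖x * (z * w)‖ ∂(P.map Z) = N (x * w) := by
    intro w
    rw [hZ.law.2 (x * w)]
    refine integral_congr_ae (Eventually.of_forall fun z => ?_)
    simp only [mul_assoc, mul_comm z w]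
  calc ∫ ω, ‖x * (Z ω * W ω)‖ ∂P
      = ∫ p, ‖x * (p.1 * p.2)‖ ∂((P.map Z).prod (P.map W)) := by
        rw [← hmap, integral_map (hmZ.prodMk hmW) hc.aestronglyMeasurable]
    _ = ∫ w, N (x * w) ∂(P.map W) := by
        rw [integral_prod_symm _ hint]
        exact integral_congr_ae (Eventually.of_forall fun w => hN w)
    _ = ∫ ω, N (x * W ω) ∂P := by
        refine integral_map hmW ?_
        have := hint.swap.integral_prod_left.aestronglyMeasurable
        refine this.congr (Eventually.of_forall fun w => ?_)
        exact hN w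

end Generators

section Multiplication

variable {d : ℕ}

theorem DNorm.exists_law (D : DNorm d) :
    ∃ P : Measure (Fin d → ℝ), Generates P (fun z => z) D := by
  obtain ⟨Ω, _, P, Z, h⟩ := D.isDNorm
  exact ⟨P.map Z, h.law⟩

/-- The law of some generator of the `D`-norm `D`. -/
noncomputable def DNorm.law (D : DNorm d) : Measure (Fin d → ℝ) := D.exists_law.choose

theorem DNorm.generates_law (D : DNorm d) : Generates D.law (fun z => z) D :=
  D.exists_law.choose_spec

theorem generates_prod {μ ν : Measure (Fin d → ℝ)} {N₁ N₂ : (Fin d → ℝ) → ℝ}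
    (h1 : Generates μ (fun z => z) N₁) (h2 : Generates ν (fun z => z) N₂) :
    Generates (μ.prod ν) (fun p => p.1) N₁ ∧ Generates (μ.prod ν) (fun p => p.2) N₂ ∧
    IndepFun (fun p : (Fin d → ℝ) × (Fin d → ℝ) => p.1) (fun p => p.2) (μ.prod ν) := by
  have := h1.1.isProbabilityMeasure
  have := h2.1.isProbabilityMeasure
  refine ⟨⟨⟨inferInstance, fun i => ?_, fun i => ?_, fun i => ?_⟩, fun x => ?_⟩,
    ⟨⟨inferInstance, fun i => ?_, fun i => ?_, fun i => ?_⟩, fun x => ?_⟩, ?_⟩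
  · exact Measure.quasiMeasurePreserving_fst.ae (h1.1.nonneg i)
  · exact (h1.1.integrable i).comp_fst _
  · exact (integral_fun_fst (fun z : Fin d → ℝ => z i)).trans (by simp [h1.1.mean_eq_one i])
  · rw [h1.2 x]
    exact ((integral_fun_fst (fun z : Fin d → ℝ => ‖x * z‖)).trans (by simp)).symm
  · exact Measure.quasiMeasurePreserving_snd.ae (h2.1.nonneg i)
  · exact (h2.1.integrable i).comp_snd _
  · exact (integral_fun_snd (fun z : Fin d → ℝ => z i)).trans (by simp [h2.1.mean_eq_one i])
  · rw [h2.2 x]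
    exact ((integral_fun_snd (fun z : Fin d → ℝ => ‖x * z‖)).trans (by simp)).symm
  · exact indepFun_prod measurable_id measurable_id

/-- The value of the product of two independent generators, by conditioning on either factor. -/
theorem integral_prod_eq {μ ν : Measure (Fin d → ℝ)} {N₁ N₂ : (Fin d → ℝ) → ℝ}
    (h1 : Generates μ (fun z => z) N₁) (h2 : Generates ν (fun z => z) N₂) (x : Fin d → ℝ) :
    ∫ p, ‖x * (p.1 * p.2)‖ ∂(μ.prod ν) = ∫ w, N₁ (x * w) ∂ν ∧
    ∫ p, ‖x * (p.1 * p.2)‖ ∂(μ.prod ν) = ∫ z, N₂ (x * z) ∂μ := by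
  have := h1.1.isProbabilityMeasure
  have := h2.1.isProbabilityMeasure
  obtain ⟨g1, g2, hi⟩ := generates_prod h1 h2
  constructor
  · rw [integral_norm_mul_mul g1 g2.1 hi x]
    exact (integral_fun_snd (fun w : Fin d → ℝ => N₁ (x * w))).trans (by simp)
  · have := integral_norm_mul_mul g2 g1.1 hi.symm x
    simp only [mul_comm (Prod.snd _)] at this
    rw [this]
    exact (integral_fun_fst (fun z : Fin d → ℝ => N₂ (x * z))).trans (by simp)

/-- The product `D₁ D₂` of two `D`-norms: the `D`-norm generated by the componentwise product of
independent generators of `D₁` and `D₂`, here the two projections on the product of the laws of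
chosen generators. `DNorm.generates_mul` shows that the choice is irrelevant. -/
noncomputable instance : Mul (DNorm d) where
  mul D₁ D₂ :=
    { toFun := fun x => ∫ p, ‖x * (p.1 * p.2)‖ ∂(D₁.law.prod D₂.law)
      isDNorm := ⟨_, _, D₁.law.prod D₂.law, fun p => p.1 * p.2,
        have h := generates_prod D₁.generates_law D₂.generates_law
        h.1.1.mul h.2.1.1 h.2.2,
        fun _ => rfl⟩ }

/-- The product of `D`-norms is well defined: if `Z` and `W` are any independent generators of
`D₁` and `D₂`, on any probability space, then `Z W` generates `D₁ D₂`. -/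
theorem DNorm.generates_mul {Ω : Type*} [MeasurableSpace Ω] {P : Measure Ω}
    {Z W : Ω → Fin d → ℝ} {D₁ D₂ : DNorm d} (hZ : Generates P Z D₁) (hW : Generates P W D₂)
    (hi : IndepFun Z W P) : Generates P (fun ω => Z ω * W ω) (D₁ * D₂).toFun := by
  refine ⟨hZ.1.mul hW.1 hi, fun x => ?_⟩
  have hP := hZ.1.isProbabilityMeasure
  have hmZ := hZ.1.aemeasurable
  have hmW := hW.1.aemeasurable
  have hc : Continuous (fun p : (Fin d → ℝ) × (Fin d → ℝ) => ‖x * (p.1 * p.2)‖) := by fun_prop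
  have hmap := (indepFun_iff_map_prod_eq_prod_map_map hmZ hmW).1 hi
  have e1 : ∫ ω, ‖x * (Z ω * W ω)‖ ∂P
      = ∫ p, ‖x * (p.1 * p.2)‖ ∂((P.map Z).prod (P.map W)) := by
    rw [← hmap, integral_map (hmZ.prodMk hmW) hc.aestronglyMeasurable]
  rw [e1, (integral_prod_eq hZ.law hW.law x).1, ← (integral_prod_eq D₁.generates_law hW.law x).1,
    (integral_prod_eq D₁.generates_law hW.law x).2]
  exact (integral_prod_eq D₁.generates_law D₂.generates_law x).2

/-- The track of a sequence of `D`-norms `D 0, D 1, …`: the `n`-th member is the product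
`D n ⋯ D 1 D 0`, so that the track of the constant sequence `D` is `D, D², D³, …`. -/
noncomputable def DNorm.track (D : ℕ → DNorm d) : ℕ → DNorm d
  | 0 => D 0
  | n + 1 => D (n + 1) * DNorm.track D n

end Multiplication

end DNormTheory

/-!
The product of `D`-norms can be computed by conditioning on either factor,
`(D₁ D₂) x = E (D₁ (x Z⁽²⁾)) = E (D₂ (x Z⁽¹⁾))` (`DNorm.mul_apply'`, `DNorm.mul_apply`), and Fubini's
theorem makes it associative. Every `D`-norm lies between `‖·‖_∞` and `‖·‖_1`. The lower bound gives
`D₂ ≤ D₁ D₂`, so the powers `Dⁿ x` increase in `n`; the upper bound keeps them bounded. Hence they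
converge.

That the limit is a `D`-norm is a compactness argument (`DNorm.exists_of_tendsto`). A limit of
generators in distribution need not generate the limit of the norms, because the components may
lose mass at infinity. However, every `D`-norm has a generator with values in the cube `[0, d]^d`:
reweight the law of `Z` by `(Z₁ + ⋯ + Z_d) / d` and replace `Z` by `d Z / (Z₁ + ⋯ + Z_d)`, which
leaves `E ‖x Z‖` unchanged by homogeneity (`DNorm.exists_generates_cube`). Probability measures on
the cube form a compact space, and on the cube `z ↦ ‖x z‖` is bounded and continuous, so that
a weak cluster point of such laws generates the limit.

Multiplication is sequentially continuous in its second factor (`DNorm.tendsto_mul_left`) by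
dominated convergence. Passing to the limit in `D Dⁿ = Dⁿ⁺¹` gives `D D* = D*`; by associativity
`Dⁿ D* = D*` for all `n`, and passing to the limit in `D* Dⁿ = D*` (multiplication being
commutative) gives `D* D* = D*`.
-/

namespace DNormTheory

variable {d : ℕ}

theorem DNorm.ext {D₁ D₂ : DNorm d} (h : ∀ x, D₁ x = D₂ x) : D₁ = D₂ := by
  obtain ⟨f, hf⟩ := D₁
  obtain ⟨g, hg⟩ := D₂
  obtain rfl : f = g := funext h
  rfl

/-! ### Bounds for `D`-norms -/

theorem DNorm.nonneg (D : DNorm d) (x : Fin d → ℝ) : 0 ≤ D x := by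
  rw [D.generates_law.2 x]
  exact integral_nonneg fun _ => norm_nonneg _

theorem DNorm.abs_le (D : DNorm d) (x : Fin d → ℝ) (i : Fin d) : |x i| ≤ D x := by
  have h := D.generates_law
  calc |x i| = |∫ z, x i * z i ∂D.law| := by
        rw [integral_const_mul, h.1.mean_eq_one i, mul_one]
    _ ≤ ∫ z, |x i * z i| ∂D.law := abs_integral_le_integral_abs
    _ ≤ ∫ z, ‖x * z‖ ∂D.law :=
        integral_mono ((h.1.integrable i).const_mul (x i)).abs (h.1.integrable_norm x)
          fun z => norm_le_pi_norm (x * z) i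
    _ = D x := (h.2 x).symm

theorem DNorm.norm_le (D : DNorm d) (x : Fin d → ℝ) : ‖x‖ ≤ D x :=
  (pi_norm_le_iff_of_nonneg (D.nonneg x)).2 fun i => D.abs_le x i

theorem DNorm.le_sum (D : DNorm d) (x : Fin d → ℝ) : D x ≤ ∑ i, |x i| := by
  have h := D.generates_law
  have hint : ∀ i ∈ Finset.univ, Integrable (fun z : Fin d → ℝ => |x i| * z i) D.law :=
    fun i _ => (h.1.integrable i).const_mul _
  calc D x = ∫ z, ‖x * z‖ ∂D.law := h.2 x
    _ ≤ ∫ z, ∑ i, |x i| * z i ∂D.law := by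
        refine integral_mono_ae (h.1.integrable_norm x) (integrable_finsetSum _ hint) ?_
        filter_upwards [ae_all_iff.2 h.1.nonneg] with z hz
        have hnn : ∀ i, 0 ≤ |x i| * z i := fun i => mul_nonneg (abs_nonneg _) (hz i)
        refine (pi_norm_le_iff_of_nonneg (Finset.sum_nonneg fun i _ => hnn i)).2 fun i => ?_
        rw [Pi.mul_apply, Real.norm_eq_abs, abs_mul, abs_of_nonneg (hz i)]
        exact Finset.single_le_sum (f := fun i => |x i| * z i) (fun j _ => hnn j)
          (Finset.mem_univ i)
    _ = ∑ i, |x i| := by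
        rw [integral_finsetSum _ hint]
        refine Finset.sum_congr rfl fun i _ => ?_
        rw [integral_const_mul, h.1.mean_eq_one i, mul_one]

theorem DNorm.apply_single_one (D : DNorm d) (i : Fin d) : D (Pi.single i 1) = 1 := by
  refine le_antisymm ((D.le_sum _).trans_eq ?_) ?_
  · rw [Finset.sum_eq_single i] <;> simp +contextual
  · simpa using D.abs_le (Pi.single i 1) i

/-! ### The algebra of `D`-norms -/

theorem DNorm.mul_apply' (D₁ D₂ : DNorm d) (x : Fin d → ℝ) :
    (D₁ * D₂) x = ∫ z, D₁ (x * z) ∂D₂.law :=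
  (integral_prod_eq D₁.generates_law D₂.generates_law x).1

theorem DNorm.mul_apply (D₁ D₂ : DNorm d) (x : Fin d → ℝ) :
    (D₁ * D₂) x = ∫ z, D₂ (x * z) ∂D₁.law :=
  (integral_prod_eq D₁.generates_law D₂.generates_law x).2

theorem DNorm.mul_comm (D₁ D₂ : DNorm d) : D₁ * D₂ = D₂ * D₁ :=
  DNorm.ext fun x => by rw [DNorm.mul_apply, DNorm.mul_apply']

/-- A `D`-norm is continuous, being Lipschitz with respect to the maximum norm. -/
theorem DNorm.continuous (D : DNorm d) : Continuous D.toFun := by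
  have h := D.generates_law
  have hP := h.1.isProbabilityMeasure
  have hZ : Integrable (fun z : Fin d → ℝ => ‖z‖) D.law :=
    (Integrable.of_eval (f := fun z : Fin d → ℝ => z) h.1.integrable).norm
  refine LipschitzWith.continuous (K := Real.toNNReal (∫ z, ‖z‖ ∂D.law)) ?_
  refine LipschitzWith.of_dist_le_mul fun x y => ?_
  rw [Real.coe_toNNReal _ (integral_nonneg fun _ => norm_nonneg _), h.2 x, h.2 y,
    Real.dist_eq, ← integral_sub (h.1.integrable_norm x) (h.1.integrable_norm y), _root_.mul_comm,
    ← integral_const_mul]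
  refine abs_integral_le_integral_abs.trans (integral_mono
    ((h.1.integrable_norm x).sub (h.1.integrable_norm y)).abs (hZ.const_mul _) fun z => ?_)
  refine (abs_norm_sub_norm_le _ _).trans ?_
  rw [← sub_mul, dist_eq_norm]
  exact norm_mul_le _ _

theorem DNorm.integrable_comp (D₁ D₂ : DNorm d) (x : Fin d → ℝ) :
    Integrable (fun z => D₁ (x * z)) D₂.law := by
  have h := D₂.generates_law
  refine (integrable_finsetSum Finset.univ fun i _ =>
    ((h.1.integrable i).const_mul (x i)).abs).mono' ?_ ?_
  · exact (D₁.continuous.comp (continuous_const.mul continuous_id)).aestronglyMeasurable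
  · filter_upwards with z
    rw [Real.norm_eq_abs, abs_of_nonneg (D₁.nonneg _)]
    exact D₁.le_sum _

theorem DNorm.mul_assoc (D₁ D₂ D₃ : DNorm d) : D₁ * D₂ * D₃ = D₁ * (D₂ * D₃) := by
  refine DNorm.ext fun x => ?_
  have h1 := D₁.generates_law
  have h2 := D₂.generates_law
  obtain ⟨g1, g2, hi⟩ := generates_prod h1 h2
  have hP1 := h1.1.isProbabilityMeasure
  have hP2 := h2.1.isProbabilityMeasure
  have h12 : Generates _ _ (D₁ * D₂).toFun := DNorm.generates_mul g1 g2 hi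
  have hcont : Continuous fun z => D₃ (x * z) :=
    D₃.continuous.comp (continuous_const.mul continuous_id)
  have hint : Integrable (fun p : (Fin d → ℝ) × (Fin d → ℝ) => D₃ (x * (p.1 * p.2)))
      (D₁.law.prod D₂.law) := by
    refine (integrable_finsetSum Finset.univ fun i _ =>
      ((h12.1.integrable i).const_mul (x i)).abs).mono' ?_ ?_
    · exact (hcont.comp (continuous_fst.mul continuous_snd)).aestronglyMeasurable
    · filter_upwards with p
      rw [Real.norm_eq_abs, abs_of_nonneg (D₃.nonneg _)]
      exact D₃.le_sum _
  rw [DNorm.mul_apply D₁]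
  simp only [DNorm.mul_apply D₂ D₃]
  -- The law of the product of the two projections generates `D₁ D₂` as well.
  rw [DNorm.mul_apply' (D₁ * D₂) D₃,
    ← (integral_prod_eq h12.law D₃.generates_law x).1,
    (integral_prod_eq h12.law D₃.generates_law x).2,
    integral_map h12.1.aemeasurable hcont.aestronglyMeasurable, integral_prod _ hint]
  simp only [_root_.mul_assoc]

theorem DNorm.le_mul (D₁ D₂ : DNorm d) (x : Fin d → ℝ) : D₂ x ≤ (D₁ * D₂) x := by
  rw [DNorm.mul_apply', D₂.generates_law.2 x]
  exact integral_mono (D₂.generates_law.1.integrable_norm x) (D₁.integrable_comp D₂ x)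
    fun z => D₁.norm_le (x * z)

/-- Multiplication of `D`-norms is sequentially continuous in the second factor for
pointwise convergence. -/
theorem DNorm.tendsto_mul_left {E : ℕ → DNorm d} {L : DNorm d}
    (h : ∀ x, Tendsto (fun n => E n x) atTop (𝓝 (L x))) (D : DNorm d) (x : Fin d → ℝ) :
    Tendsto (fun n => (D * E n) x) atTop (𝓝 ((D * L) x)) := by
  simp only [DNorm.mul_apply]
  refine tendsto_integral_of_dominated_convergence (fun z => ∑ i, |x i * z i|) (fun n => ?_)
    (integrable_finsetSum Finset.univ fun i _ =>
      ((D.generates_law.1.integrable i).const_mul (x i)).abs) (fun n => ?_) ?_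
  · exact ((E n).integrable_comp D x).aestronglyMeasurable
  · filter_upwards with z
    rw [Real.norm_eq_abs, abs_of_nonneg ((E n).nonneg _)]
    exact (E n).le_sum _
  · filter_upwards with z using h _

/-! ### Generators in a cube and limits of `D`-norms -/

/-- The cube `[0, d]^d`, which contains the vectors with nonnegative components and sum `d`. -/
abbrev Cube (d : ℕ) : Type := Set.Icc (0 : Fin d → ℝ) (fun _ => (d : ℝ))

/-- The nonnegative vector `z ≠ 0` is rescaled to the sum `d`. Other vectors are mapped to
irrelevant points; the truncation only serves to make the map total. -/
noncomputable def rescale (z : Fin d → ℝ) : Cube d :=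
  ⟨fun i => max 0 (min d (d * z i / ∑ j, z j)),
    fun _ => le_max_left _ _, fun _ => max_le d.cast_nonneg (min_le_left _ _)⟩

theorem measurable_rescale : Measurable (rescale (d := d)) := by
  refine Measurable.subtype_mk (measurable_pi_lambda _ fun i => ?_)
  fun_prop

theorem sum_div_mul_norm_rescale (hd : 0 < d) (x : Fin d → ℝ) {z : Fin d → ℝ} (hz : ∀ i, 0 ≤ z i) :
    (∑ j, z j) / d * ‖x * (rescale z : Fin d → ℝ)‖ = ‖x * z‖ := by
  have hd' : (0 : ℝ) < d := by exact_mod_cast hd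
  have hs : 0 ≤ ∑ j, z j := Finset.sum_nonneg fun j _ => hz j
  have hle : ∀ i, z i ≤ ∑ j, z j := fun i =>
    Finset.single_le_sum (fun j _ => hz j) (Finset.mem_univ i)
  rw [← abs_of_nonneg (div_nonneg hs hd'.le), ← Real.norm_eq_abs, ← norm_smul]
  congr 1
  ext i
  simp only [Pi.smul_apply, Pi.mul_apply, smul_eq_mul, rescale]
  rcases hs.eq_or_lt with h0 | h0
  · have : z i = 0 := le_antisymm (h0 ▸ hle i) (hz i)
    simp [← h0, this]
  · have h1 : d * z i / ∑ j, z j ≤ d := by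
      rw [div_le_iff₀ h0]
      exact mul_le_mul_of_nonneg_left (hle i) hd'.le
    rw [min_eq_right h1, max_eq_right (div_nonneg (mul_nonneg hd'.le (hz i)) hs)]
    field_simp

/-- Every `D`-norm is generated by a random vector with values in the cube `[0, d]^d`. -/
theorem DNorm.exists_generates_cube (hd : 0 < d) (D : DNorm d) :
    ∃ P : ProbabilityMeasure (Cube d),
      ∀ x, ∫ z, ‖x * (z : Fin d → ℝ)‖ ∂(P : Measure (Cube d)) = D x := by
  have h := D.generates_law
  have hd' : (0 : ℝ) < d := by exact_mod_cast hd
  have hS : Integrable (fun z : Fin d → ℝ => (∑ j, z j) / d) D.law :=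
    (integrable_finsetSum _ fun i _ => h.1.integrable i).div_const _
  have hm : Measurable fun z : Fin d → ℝ => ((∑ j, z j) / d).toNNReal := by fun_prop
  have hpos : ∀ᵐ z ∂D.law, 0 ≤ (∑ j, z j) / (d : ℝ) := by
    filter_upwards [ae_all_iff.2 h.1.nonneg] with z hz
    exact div_nonneg (Finset.sum_nonneg fun j _ => hz j) hd'.le
  set ν := D.law.withDensity fun z => (((∑ j, z j) / d).toNNReal : ENNReal) with hν
  have hprob : IsProbabilityMeasure ν := by
    constructor
    rw [hν, withDensity_apply _ MeasurableSet.univ, Measure.restrict_univ]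
    change ∫⁻ z, ENNReal.ofReal ((∑ j, z j) / d) ∂D.law = 1
    rw [← ofReal_integral_eq_lintegral_ofReal hS hpos, integral_div,
      integral_finsetSum _ fun i _ => h.1.integrable i]
    simp [h.1.mean_eq_one, hd'.ne']
  refine ⟨⟨ν.map rescale, Measure.isProbabilityMeasure_map measurable_rescale.aemeasurable⟩,
    fun x => ?_⟩
  have hc : Continuous fun z : Cube d => ‖x * (z : Fin d → ℝ)‖ :=
    (continuous_norm_mul x).comp continuous_subtype_val
  rw [ProbabilityMeasure.coe_mk,
    integral_map measurable_rescale.aemeasurable hc.aestronglyMeasurable, hν,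
    integral_withDensity_eq_integral_smul hm, h.2 x]
  refine integral_congr_ae ?_
  filter_upwards [ae_all_iff.2 h.1.nonneg, hpos] with z hz hz'
  rw [NNReal.smul_def, Real.coe_toNNReal _ hz', smul_eq_mul, sum_div_mul_norm_rescale hd x hz]

/-- The set of `D`-norms is closed under pointwise convergence. -/
theorem DNorm.exists_of_tendsto {ι : Type*} {l : Filter ι} [l.NeBot] {D : ι → DNorm d}
    {N : (Fin d → ℝ) → ℝ} (h : ∀ x, Tendsto (fun n => D n x) l (𝓝 (N x))) :
    ∃ L : DNorm d, ∀ x, L x = N x := by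
  rcases Nat.eq_zero_or_pos d with rfl | hd
  · -- On `ℝ^0` the only `D`-norm is zero.
    obtain ⟨n⟩ := l.nonempty_of_neBot
    have h0 : ∀ (E : DNorm 0) x, E x = 0 := fun E x =>
      le_antisymm (by simpa using E.le_sum x) (E.nonneg x)
    refine ⟨D n, fun x => tendsto_nhds_unique ?_ (h x)⟩
    simp only [h0]
    exact tendsto_const_nhds
  choose P hP using fun n => (D n).exists_generates_cube hd
  let u := Ultrafilter.of l
  have hlim : Tendsto P u (𝓝 (u.map P).lim) := (u.map P).le_nhds_lim
  set Q := (u.map P).lim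
  have hQ : ∀ x, ∫ z, ‖x * (z : Fin d → ℝ)‖ ∂(Q : Measure (Cube d)) = N x := fun x => by
    have hc : Continuous fun z : Cube d => ‖x * (z : Fin d → ℝ)‖ :=
      (continuous_norm_mul x).comp continuous_subtype_val
    have := ProbabilityMeasure.tendsto_iff_forall_integral_tendsto.1 hlim
      (BoundedContinuousFunction.mkOfCompact ⟨_, hc⟩)
    simp only [BoundedContinuousFunction.mkOfCompact_apply, ContinuousMap.coe_mk, hP] at this
    exact tendsto_nhds_unique this ((h x).mono_left (Ultrafilter.of_le l))
  have hcoord : ∀ (i : Fin d) (z : Cube d),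
      ‖(Pi.single i 1 : Fin d → ℝ) * (z : Fin d → ℝ)‖ = (z : Fin d → ℝ) i := fun i z => by
    have hsingle : (Pi.single i 1 : Fin d → ℝ) * (z : Fin d → ℝ)
        = Pi.single i ((z : Fin d → ℝ) i) := by
      ext j
      rcases eq_or_ne j i with rfl | hj
      · simp
      · simp [hj]
    rw [hsingle, Pi.norm_single, Real.norm_of_nonneg (z.2.1 i)]
  refine ⟨⟨N, _, _, (Q : Measure (Cube d)), fun z => z, ⟨inferInstance, fun i => ?_, fun i => ?_,
    fun i => ?_⟩, fun x => (hQ x).symm⟩, fun _ => rfl⟩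
  · exact Eventually.of_forall fun z => z.2.1 i
  · refine Integrable.of_bound (C := d)
      ((continuous_apply i).comp continuous_subtype_val).aestronglyMeasurable
      (Eventually.of_forall fun z => ?_)
    rw [Real.norm_of_nonneg (z.2.1 i)]
    exact z.2.2 i
  · -- The mean of the `i`-th component is the value of the limit at the `i`-th unit vector.
    have h1 := hQ (Pi.single i 1)
    simp only [hcoord] at h1
    rw [h1]
    refine tendsto_nhds_unique (h (Pi.single i 1)) ?_
    simp only [DNorm.apply_single_one]
    exact tendsto_const_nhds

end DNormTheory

/-! ### Convergence of powers -/

open DNormTheory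

theorem mainTheorem4 (d : ℕ) (D : DNormTheory.DNorm d) :
    ∃ Dstar : DNormTheory.DNorm d,
      (∀ x : Fin d → ℝ, Monotone (fun n : ℕ => DNormTheory.DNorm.track (fun _ => D) n x)) ∧
      (∀ x : Fin d → ℝ, Filter.Tendsto
        (fun n : ℕ => DNormTheory.DNorm.track (fun _ => D) n x) Filter.atTop (nhds (Dstar x))) ∧
      IsIdempotentElem Dstar := by
  have hmono : ∀ x : Fin d → ℝ, Monotone fun n : ℕ => DNorm.track (fun _ => D) n x := fun x =>
    monotone_nat_of_le_succ fun n => D.le_mul _ x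
  have hbdd : ∀ x : Fin d → ℝ,
      BddAbove (Set.range fun n : ℕ => DNorm.track (fun _ => D) n x) := fun x =>
    ⟨∑ i, |x i|, by rintro _ ⟨n, rfl⟩; exact DNorm.le_sum _ x⟩
  obtain ⟨L, hL⟩ := DNorm.exists_of_tendsto fun x => tendsto_atTop_ciSup (hmono x) (hbdd x)
  have hlim : ∀ x, Tendsto (fun n => DNorm.track (fun _ => D) n x) atTop (𝓝 (L x)) := fun x => by
    rw [hL x]
    exact tendsto_atTop_ciSup (hmono x) (hbdd x)
  have hDL : D * L = L := DNorm.ext fun x =>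
    tendsto_nhds_unique (DNorm.tendsto_mul_left hlim D x) ((tendsto_add_atTop_iff_nat 1).2 (hlim x))
  have htrack : ∀ n, DNorm.track (fun _ => D) n * L = L := fun n => by
    induction n with
    | zero => exact hDL
    | succ n ih => rw [DNorm.track, DNorm.mul_assoc, ih, hDL]
  refine ⟨L, hmono, hlim, DNorm.ext fun x => ?_⟩
  refine tendsto_nhds_unique (DNorm.tendsto_mul_left hlim L x) ?_
  simp only [DNorm.mul_comm L, htrack]
  exact tendsto_const_nhds
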